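/- Let $N,r,d$ be positive integers and let $G$ be an undirected weighted network with nodes $\{1,\dots,N\}$: a reflexive symmetric neighboring relation $x\sim y$ and weights $\omega(x,y)=\omega(y,x)\ge 0$ with $\omega(x,y)>0$ if and only if $x\sim y$. Each edge $(x,y)$, $x\sim y$, carries a label $T(x,y)=T(y,x)\in\mathcal I=\{1,\dots,r\}$. Put $\omega_i(x,y)=\omega(x,y)$ if $x\sim y$ and $T(x,y)=i$, and $\omega_i(x,y)=0$ otherwise. Let $L^2$ be the space of all functions $f:\{1,\dots,N\}\to\mathbb R^d$ with inner product $(f,g)=\sum_x f(x)\cdot g(x)$, let $H^1\subset L^2$ be the subspace of functions with zero average, and for $i\in\mathcal I$ let $\Delta_i f(x)=\sum_{y}\omega_i(x,y)\,(f(y)-f(x))$. For linear operators $A,B$ on $L^2$ write $A<B$ on $H^1$ (respectively $A\le B$ on $H^1$) if $(u,(B-A)u)>0$ (respectively $\ge 0$) for all $u\in H^1\setminus\{0\}$. For constant delays $\tau_i\ge 0$ and $\bar\tau=\max_i\tau_i$ consider $$\dot v_1(t)=\sum_{i\in\mathcal I}\Delta_i v_1(t-\tau_i)\quad(t\ge 0),\qquad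 v_1(t)\in H^1, \tag{1}$$ whose solutions are the continuous $v_1:[-\bar\tau,\infty)\to H^1$ that satisfy (1) for all $t\ge0$ (with the right derivative at $t=0$). The zero solution of (1) is globally exponentially stable if there are $M,\gamma>0$ such that $\|v_1(t)\|\le M e^{-\gamma t}\sup_{s\in[-\bar\tau,0]}\|v_1(s)\|$ for every solution $v_1$ and every $t\ge0$. It is globally asymptotically stable if it is Lyapunov stable (for every $\varepsilon>0$ there is $\delta>0$ such that every solution with $\|v_1(s)\|<\delta$ for all $s\in[-\bar\tau,0]$ satisfies $\|v_1(t)\|<\varepsilon$ for all $t\ge0$) and every solution tends to $0$ as $t\to\infty$. Fix $i'\in\mathcal I$. 1. If $\Delta_{i'}<\sum_{i\in\mathcal I\setminus\{i'\}}\Delta_i$ on $H^1$, then the zero solution of (1) with $\tau_{i'}=0$ is globally exponentially stable for all $\tau_i\ge0$, $i\in\mathcal I\setminus\{i'\}$. 2. Conversely, if the zero solution of (1) with $\tau_{i'}=0$ is globally asymptotically stable for all $\tau_i\ge0$, $i\in\mathcal I\setminus\{i'\}$, then $\Delta_{i'}\le\sum_{i\in\mathcal I\setminus\{i'\}}\Delta_i$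 on $H^1$. -/

import Mathlib

open Set Filter Topology

noncomputable section

/-- An undirected weighted communication network on the nodes `Fin N` whose edges carry one of the
`r` delay labels, symmetrically. The neighboring relation is reflexive. Every label may carry any
number of edges, including none. -/
structure DelayNetwork (N r : ℕ) where
  /-- the neighboring relation `x ∼ y` -/
  nbr : Fin N → Fin N → Prop
  nbr_refl : ∀ x, nbr x x
  nbr_symm : ∀ x y, nbr x y → nbr y x
  /-- the weights `ω(x, y)` -/
  weight : Fin N → Fin N → ℝ
  weight_nonneg : ∀ x y, 0 ≤ weight x y
  weight_symm : ∀ x y, weight x y = weight y x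
  weight_pos_iff : ∀ x y, 0 < weight x y ↔ nbr x y
  /-- the label `i` of the delay `τ_i` that affects the edge `(x, y)` -/
  label : ∀ x y, nbr x y → Fin r
  label_symm : ∀ x y (h : nbr x y), label y x (nbr_symm x y h) = label x y h

/-- The Hilbert space `L²(G|ℝᵈ)` of functions from the nodes to `ℝᵈ`, with inner product
`(f, g) = ∑ x, f(x) · g(x)`. -/
def GraphL2 (N d : ℕ) : Type := PiLp 2 (fun _ : Fin N => EuclideanSpace ℝ (Fin d))

namespace GraphL2

variable {N d : ℕ}

instance : NormedAddCommGroup (GraphL2 N d) :=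
  inferInstanceAs (NormedAddCommGroup (PiLp 2 (fun _ : Fin N => EuclideanSpace ℝ (Fin d))))

instance : InnerProductSpace ℝ (GraphL2 N d) :=
  inferInstanceAs (InnerProductSpace ℝ (PiLp 2 (fun _ : Fin N => EuclideanSpace ℝ (Fin d))))

instance : FiniteDimensional ℝ (GraphL2 N d) :=
  inferInstanceAs (FiniteDimensional ℝ (PiLp 2 (fun _ : Fin N => EuclideanSpace ℝ (Fin d))))

instance : CoeFun (GraphL2 N d) (fun _ => Fin N → EuclideanSpace ℝ (Fin d)) :=
  ⟨fun f => WithLp.ofLp f⟩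

/-- The element of `L²` given by a function on the nodes. -/
def of (f : Fin N → EuclideanSpace ℝ (Fin d)) : GraphL2 N d := WithLp.toLp 2 f

theorem of_apply (f : Fin N → EuclideanSpace ℝ (Fin d)) (x : Fin N) : of f x = f x := rfl

theorem ext {f g : GraphL2 N d} (h : ∀ x, f x = g x) : f = g := PiLp.ext h

theorem zero_apply (x : Fin N) : (0 : GraphL2 N d) x = 0 := rfl

theorem add_apply (f g : GraphL2 N d) (x : Fin N) : (f + g) x = f x + g x := rfl

theorem smul_apply (c : ℝ) (f : GraphL2 N d) (x : Fin N) : (c • f) x = c • f x := rfl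

theorem inner_eq_sum (f g : GraphL2 N d) : inner ℝ f g = ∑ x, inner ℝ (f x) (g x) :=
  PiLp.inner_apply (𝕜 := ℝ) (f := fun _ : Fin N => EuclideanSpace ℝ (Fin d)) f g

end GraphL2

/-- The average of a function on the nodes. -/
def graphAverage {N d : ℕ} (f : GraphL2 N d) : EuclideanSpace ℝ (Fin d) :=
  (N : ℝ)⁻¹ • ∑ x, f x

/-- The space `H¹(G|ℝᵈ)` of functions with zero average. -/
def graphH1 (N d : ℕ) : Submodule ℝ (GraphL2 N d) where
  carrier := {f | graphAverage f = 0}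
  zero_mem' := by simp [graphAverage, GraphL2.zero_apply]
  add_mem' := by
    intro f g hf hg
    simp only [graphAverage, mem_ofPred_eq] at hf hg ⊢
    simp only [GraphL2.add_apply, Finset.sum_add_distrib, smul_add, hf, hg, add_zero]
  smul_mem' := by
    intro c f hf
    simp only [graphAverage, mem_ofPred_eq] at hf ⊢
    simp only [GraphL2.smul_apply, ← Finset.smul_sum]
    rw [smul_comm, hf, smul_zero]

/-- The Laplacian `Δ f(x) = ∑ y, w(x, y) (f(y) - f(x))` associated to the weights `w`. -/
def weightedLaplacian {N : ℕ} (d : ℕ) (w : Fin N → Fin N → ℝ) :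
    GraphL2 N d →ₗ[ℝ] GraphL2 N d where
  toFun f := GraphL2.of (fun x => ∑ y, w x y • (f y - f x))
  map_add' f g := by
    refine GraphL2.ext fun x => ?_
    simp only [GraphL2.of_apply, GraphL2.add_apply, ← Finset.sum_add_distrib, ← smul_add]
    refine Finset.sum_congr rfl fun y _ => ?_
    congr 1
    abel
  map_smul' c f := by
    refine GraphL2.ext fun x => ?_
    simp only [GraphL2.of_apply, GraphL2.smul_apply, RingHom.id_apply, Finset.smul_sum,
      ← smul_sub]
    exact Finset.sum_congr rfl fun y _ => smul_comm _ _ _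

namespace DelayNetwork

variable {N r : ℕ}

open Classical in
/-- The weights `ω_i` of the subgraph of the edges labelled `i`. -/
def subWeight (G : DelayNetwork N r) (i : Fin r) (x y : Fin N) : ℝ :=
  if ∃ h : G.nbr x y, G.label x y h = i then G.weight x y else 0

/-- The Laplacian `Δ_i` of the subgraph of the edges labelled `i`. -/
def subLaplacian (G : DelayNetwork N r) (d : ℕ) (i : Fin r) :
    GraphL2 N d →ₗ[ℝ] GraphL2 N d :=
  weightedLaplacian d (G.subWeight i)

/-- `v` is a solution, with continuous initial data on `[-max τ_i, 0]`, of
`v'(t) = ∑ i, Δ_i v(t - τ_i)` for `t ≥ 0`, `v(t) ∈ H¹`. The derivative is one-sided at `0`; the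
values of `v` before `-max τ_i` play no role. -/
structure IsSolution (G : DelayNetwork N r) {d : ℕ} (τ : Fin r → ℝ) (v : ℝ → GraphL2 N d) :
    Prop where
  continuousOn : ContinuousOn v (Ici (-(⨆ i, τ i)))
  mem_H1 : ∀ t ∈ Ici (-(⨆ i, τ i)), v t ∈ graphH1 N d
  hasDeriv : ∀ t ∈ Ici (0 : ℝ),
    HasDerivWithinAt v (∑ i, G.subLaplacian d i (v (t - τ i))) (Ici 0) t

/-- The zero solution is globally exponentially stable:
`‖v(t)‖ ≤ M e^{-γ t} sup_{[-max τ_i, 0]} ‖v‖` for all solutions `v` and all `t ≥ 0`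
(the supremum is expressed through its upper bounds `ρ`). -/
def GloballyExponentiallyStable (G : DelayNetwork N r) (d : ℕ) (τ : Fin r → ℝ) : Prop :=
  ∃ M > 0, ∃ γ > 0, ∀ v : ℝ → GraphL2 N d, G.IsSolution τ v →
    ∀ ρ : ℝ, (∀ s ∈ Icc (-(⨆ i, τ i)) 0, ‖v s‖ ≤ ρ) →
      ∀ t : ℝ, 0 ≤ t → ‖v t‖ ≤ M * Real.exp (-γ * t) * ρ

/-- The zero solution is globally asymptotically stable: it is stable in the sense of Lyapunov and
every solution converges to zero. -/
def GloballyAsymptoticallyStable (G : DelayNetwork N r) (d : ℕ) (τ : Fin r → ℝ) : Prop :=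
  (∀ ε > 0, ∃ δ > 0, ∀ v : ℝ → GraphL2 N d, G.IsSolution τ v →
    (∀ s ∈ Icc (-(⨆ i, τ i)) 0, ‖v s‖ < δ) → ∀ t : ℝ, 0 ≤ t → ‖v t‖ < ε) ∧
  ∀ v : ℝ → GraphL2 N d, G.IsSolution τ v → Tendsto v atTop (𝓝 0)

end DelayNetwork

/-- `A < B` on `H¹`. -/
def LtOnH1 {N d : ℕ} (A B : GraphL2 N d →ₗ[ℝ] GraphL2 N d) : Prop :=
  ∀ u ∈ graphH1 N d, u ≠ 0 → 0 < inner ℝ u ((B - A) u)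

/-- `A ≤ B` on `H¹`. -/
def LeOnH1 {N d : ℕ} (A B : GraphL2 N d →ₗ[ℝ] GraphL2 N d) : Prop :=
  ∀ u ∈ graphH1 N d, u ≠ 0 → 0 ≤ inner ℝ u ((B - A) u)

end

/-!
Write `B = -Δ_{i'}` for the undelayed operator and `A_i = -Δ_i` for the others. By summation by
parts all of them are positive operators that map into `H¹`.

*Sufficiency.* Suppose that `B - ∑ A_i` is positive definite on `H¹`. For a small rate `γ > 0` the
weighted energy
`e^{2γt} ‖v(t)‖² + ∑ ∫ s in t - τ_i..t, e^{2γ(s + τ_i)} (v(s), A_i v(s))`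
is nonincreasing along solutions (`norm_sq_le_of_delay_equation`): Young's inequality for the form
of `A_i` bounds the cross term `-2 (v(t), A_i v(t - τ_i))` by
`(v(t), A_i v(t)) + (v(t - τ_i), A_i v(t - τ_i))`, the second summand is cancelled by the lower
endpoint of the integral, and what remains at time `t` is absorbed by `B` up to `O(γ)`. The energy
at time `0` is at most a constant times the square of the supremum of the initial data.

*Necessity.* Give all labels other than `i'` the same delay `τ`, and put `A = ∑ A_i`. If `A` and `B`
have a common kernel vector in `H¹`, it is a constant solution. Otherwise consider the pencil
`B + e^{iθ}A` on the complexification of `H¹`. At `θ = 0` its spectrum lies in the open right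
half-plane. If `B - A` is not positive semidefinite, then at `θ = π` there is a negative eigenvalue.
Since the spectrum is upper and lower hemicontinuous, some eigenvalue is imaginary for an angle
`θ ∈ (0, π)` (`exists_spectrum_re_eq_zero`), and the imaginary part of the eigenvalue equation shows
that it is `ib` with `b > 0` (`exists_imaginary_eigenvalue_pencil`). An eigenvector `w` then gives
the periodic solution `Re (e^{-ibt} w)` for the delay `τ = θ / b`, which does not tend to zero.
-/

/-! ### Eigenvalues crossing the imaginary axis -/

/-- Lower hemicontinuity of the spectrum: since `|det (l - M)|` is the product of the distances of
`l` to the eigenvalues of `M`, a small determinant forces an eigenvalue near `l`. -/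
theorem eventually_exists_mem_spectrum_norm_sub_lt {n : Type*} [Fintype n] [DecidableEq n]
    {M₀ : Matrix n n ℂ} {l : ℂ} (hl : l ∈ spectrum ℂ M₀) {ε : ℝ} (hε : 0 < ε) :
    ∀ᶠ M in 𝓝 M₀, ∃ z ∈ spectrum ℂ M, ‖l - z‖ < ε := by
  have hcont : Continuous fun M : Matrix n n ℂ => ‖M.charpoly.eval l‖ := by
    simp only [Matrix.eval_charpoly]
    fun_prop
  have h0 : ‖M₀.charpoly.eval l‖ < ε ^ Fintype.card n := by
    rw [Matrix.mem_spectrum_iff_isRoot_charpoly] at hl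
    rw [hl.eq_zero, norm_zero]
    positivity
  filter_upwards [hcont.continuousAt.eventually_lt_const h0] with M hM
  by_contra! hfar
  have hs : M.charpoly.Splits := IsAlgClosed.splits _
  refine hM.not_ge ?_
  have hprod := Multiset.prod_map_le_prod_map₀ (s := M.charpoly.roots) (fun _ => ε)
    (fun z => ‖l - z‖) (fun _ _ => hε.le) fun z hz => hfar z <|
      Matrix.mem_spectrum_iff_isRoot_charpoly.2 (Polynomial.isRoot_of_mem_roots hz)
  rw [Multiset.map_const', Multiset.prod_replicate, ← hs.natDegree_eq_card_roots,
    M.charpoly_natDegree_eq_dim] at hprod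
  refine hprod.trans_eq ?_
  rw [hs.eval_eq_prod_roots_of_monic M.charpoly_monic]
  exact M.charpoly.roots.prod_hom' (NormedField.toMulRingNorm ℂ) fun z => l - z

/-- If the spectrum of a continuous family of matrices lies in the open right half-plane at one end
of an interval and meets the open left half-plane at the other end, then some eigenvalue is
imaginary in between: both conditions are open and the interval is connected. -/
theorem exists_spectrum_re_eq_zero {n : Type*} [Fintype n] [DecidableEq n]
    {K : ℝ → Matrix n n ℂ} (hK : Continuous K) {a b : ℝ} (hab : a ≤ b)
    (ha : ∀ z ∈ spectrum ℂ (K a), 0 < z.re) (hb : ∃ z ∈ spectrum ℂ (K b), z.re < 0) :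
    ∃ t ∈ Ioo a b, ∃ z ∈ spectrum ℂ (K t), z.re = 0 := by
  let _ : NormedRing (Matrix n n ℂ) := Matrix.linftyOpNormedRing
  let _ : NormedAlgebra ℂ (Matrix n n ℂ) := Matrix.linftyOpNormedAlgebra
  set U : Set ℝ := {t | ∀ z ∈ spectrum ℂ (K t), 0 < z.re} with hU
  set V : Set ℝ := {t | ∃ z ∈ spectrum ℂ (K t), z.re < 0} with hV
  have hUo : IsOpen U := by
    refine isOpen_iff_mem_nhds.2 fun t ht => ?_
    have hopen : IsOpen {z : ℂ | 0 < z.re} := isOpen_lt continuous_const Complex.continuous_re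
    filter_upwards [hK.continuousAt.eventually
      (upperHemicontinuous_spectrum ℂ (Matrix n n ℂ) (K t) _ (hopen.mem_nhdsSet.2 ht))] with s hs
    exact hopen.mem_nhdsSet.1 hs
  have hVo : IsOpen V := by
    refine isOpen_iff_mem_nhds.2 fun t ⟨z, hz, hz0⟩ => ?_
    filter_upwards [hK.continuousAt.eventually
      (eventually_exists_mem_spectrum_norm_sub_lt hz (neg_pos.2 hz0))] with s ⟨w, hw, hzw⟩
    refine ⟨w, hw, ?_⟩
    have := (Complex.abs_re_le_norm (z - w)).trans_lt hzw
    rw [Complex.sub_re, abs_lt] at this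
    linarith [this.1]
  have hcover : ¬ Icc a b ⊆ U ∪ V := fun h => by
    obtain ⟨t, -, htU, z, hz, hz0⟩ := isPreconnected_Icc U V hUo hVo h
      ⟨a, left_mem_Icc.2 hab, ha⟩ ⟨b, right_mem_Icc.2 hab, hb⟩
    exact hz0.not_gt (htU z hz)
  obtain ⟨t, ht, htUV⟩ := not_subset.1 hcover
  rw [mem_union, not_or] at htUV
  obtain ⟨htU, htV⟩ := htUV
  have hta : t ≠ a := fun h => htU (h ▸ ha)
  have htb : t ≠ b := fun h => htV (h ▸ hb)
  simp only [hU, hV, mem_ofPred_eq, not_forall, not_exists, not_and, not_lt] at htU htV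
  obtain ⟨z, hz, hz0⟩ := htU
  exact ⟨t, ⟨lt_of_le_of_ne ht.1 hta.symm, lt_of_le_of_ne ht.2 htb⟩, z, hz,
    le_antisymm hz0 (htV z hz)⟩

/-! ### Complex combinations of real operators -/

/-- The complex matrix of `X + iY`, for real operators `X` and `Y`, in a real basis. -/
noncomputable def complexMatrix {n E : Type*} [Fintype n] [DecidableEq n] [AddCommGroup E]
    [Module ℝ E] (β : Module.Basis n ℝ E) (X Y : E →ₗ[ℝ] E) : Matrix n n ℂ :=
  Matrix.of fun j k => ⟨LinearMap.toMatrix β β X j k, LinearMap.toMatrix β β Y j k⟩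

/-- The eigenvalue equation `(X + iY)(p + iq) = z (p + iq)`, split into real and imaginary
parts. -/
theorem mem_spectrum_complexMatrix_iff {n E : Type*} [Fintype n] [DecidableEq n] [AddCommGroup E]
    [Module ℝ E] (β : Module.Basis n ℝ E) (X Y : E →ₗ[ℝ] E) (z : ℂ) :
    z ∈ spectrum ℂ (complexMatrix β X Y) ↔ ∃ p q : E, (p ≠ 0 ∨ q ≠ 0) ∧
      X p - Y q = z.re • p - z.im • q ∧ X q + Y p = z.re • q + z.im • p := by
  have key : ∀ p q : E, (complexMatrix β X Y).mulVec (fun k => ⟨β.repr p k, β.repr q k⟩) =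
      fun k => ⟨β.repr (X p - Y q) k, β.repr (X q + Y p) k⟩ := by
    intro p q
    funext j
    have h (Z : E →ₗ[ℝ] E) (u : E) :
        β.repr (Z u) j = ∑ k, LinearMap.toMatrix β β Z j k * β.repr u k := by
      rw [← LinearMap.toMatrix_mulVec_repr β β]; rfl
    apply Complex.ext
    · simp [Matrix.mulVec, dotProduct, complexMatrix, h, Complex.re_sum, Finset.sum_sub_distrib]
    · simp [Matrix.mulVec, dotProduct, complexMatrix, h, Complex.im_sum, Finset.sum_add_distrib]
  have hsmul : ∀ p q : E, (z • fun k => (⟨β.repr p k, β.repr q k⟩ : ℂ)) =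
      fun k => ⟨β.repr (z.re • p - z.im • q) k, β.repr (z.re • q + z.im • p) k⟩ := by
    intro p q
    funext j
    apply Complex.ext <;> simp
  have hext : ∀ p q p' q' : E, ((fun k => (⟨β.repr p k, β.repr q k⟩ : ℂ)) =
      fun k => ⟨β.repr p' k, β.repr q' k⟩) ↔ p = p' ∧ q = q' := by
    intro p q p' q'
    simp only [funext_iff, Complex.ext_iff, forall_and, ← Module.Basis.ext_elem_iff]
  have hzero : (0 : n → ℂ) = fun k => ⟨β.repr 0 k, β.repr 0 k⟩ := by
    funext j; simp; rfl
  rw [← Matrix.spectrum_toLin', ← Module.End.hasEigenvalue_iff_mem_spectrum]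
  constructor
  · intro hz
    obtain ⟨w, hw⟩ := hz.exists_hasEigenvector
    obtain ⟨p, q, rfl⟩ : ∃ p q : E, w = fun k => ⟨β.repr p k, β.repr q k⟩ :=
      ⟨β.equivFun.symm fun k => (w k).re, β.equivFun.symm fun k => (w k).im, by
        funext k
        simp only [← Module.Basis.equivFun_apply, LinearEquiv.apply_symm_apply]⟩
    refine ⟨p, q, ?_, ?_⟩
    · have := hw.2
      rw [hzero, Ne, hext, not_and_or] at this
      exact this
    · have := hw.apply_eq_smul
      rw [Matrix.toLin'_apply, key, hsmul, hext] at this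
      exact this
  · rintro ⟨p, q, hpq, h⟩
    refine Module.End.hasEigenvalue_of_hasEigenvector
      (x := fun k => (⟨β.repr p k, β.repr q k⟩ : ℂ)) ⟨?_, ?_⟩
    · rw [Module.End.mem_eigenspace_iff, Matrix.toLin'_apply, key, hsmul, hext]
      exact h
    · rw [hzero, Ne, hext, not_and_or]
      exact hpq

section Pencil

variable {E : Type*} [NormedAddCommGroup E] [InnerProductSpace ℝ E]

/-- The quadratic form of a positive operator vanishes only on its kernel. -/
theorem LinearMap.IsPositive.apply_eq_zero_of_inner_eq_zero {A : E →ₗ[ℝ] E} (hA : A.IsPositive)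
    {u : E} (hu : inner ℝ u (A u) = 0) : A u = 0 := by
  -- The form is nonnegative at `t • u - A u` for all `t`, where it is affine in `t` with slope
  -- `-2 ‖A u‖²`; the value of `t` below makes it negative if `A u ≠ 0`.
  by_contra hne
  have hpos : 0 < ‖A u‖ ^ 2 := by positivity
  set t : ℝ := inner ℝ (A u) (A (A u)) / ‖A u‖ ^ 2 + 1 with ht
  have h := hA.inner_nonneg_right (t • u - A u)
  have hsymm : inner ℝ u (A (A u)) = ‖A u‖ ^ 2 := by
    rw [← hA.isSymmetric, real_inner_self_eq_norm_sq]
  simp only [map_sub, map_smul, inner_sub_left, inner_sub_right, real_inner_smul_left,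
    real_inner_smul_right, hu, hsymm, real_inner_self_eq_norm_sq] at h
  have htn : t * ‖A u‖ ^ 2 = inner ℝ (A u) (A (A u)) + ‖A u‖ ^ 2 := by
    rw [ht, add_mul, div_mul_cancel₀ _ hpos.ne', one_mul]
  linarith [hA.inner_nonneg_right (A u)]

/-- The two energy identities of an eigenvector `p + iq` of `B + e^{iθ}A`, with `c = cos θ` and
`s = sin θ`: the real and imaginary parts of the eigenvalue times `‖p‖² + ‖q‖²`. -/
theorem pencil_energy {A B : E →ₗ[ℝ] E} (hA : A.IsSymmetric) (hB : B.IsSymmetric)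
    {c s x y : ℝ} {p q : E}
    (h₁ : (B + c • A) p - (s • A) q = x • p - y • q)
    (h₂ : (B + c • A) q + (s • A) p = x • q + y • p) :
    inner ℝ p (B p) + inner ℝ q (B q) + c * (inner ℝ p (A p) + inner ℝ q (A q)) =
        x * (‖p‖ ^ 2 + ‖q‖ ^ 2) ∧
      s * (inner ℝ p (A p) + inner ℝ q (A q)) = y * (‖p‖ ^ 2 + ‖q‖ ^ 2) := by
  have hAs : inner ℝ q (A p) = inner ℝ p (A q) := by rw [← hA, real_inner_comm]
  have hBs : inner ℝ q (B p) = inner ℝ p (B q) := by rw [← hB, real_inner_comm]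
  have hqp : inner ℝ q p = inner ℝ p q := real_inner_comm _ _
  have e1 := congrArg (inner ℝ p) h₁
  have e2 := congrArg (inner ℝ q) h₂
  have e3 := congrArg (inner ℝ q) h₁
  have e4 := congrArg (inner ℝ p) h₂
  simp only [LinearMap.add_apply, LinearMap.smul_apply, inner_add_right, inner_sub_right,
    real_inner_smul_right, real_inner_self_eq_norm_sq, hAs, hBs, hqp] at e1 e2 e3 e4
  exact ⟨by linarith, by linarith⟩

/-- A symmetric operator whose quadratic form takes a negative value has a negative eigenvalue. -/
theorem LinearMap.IsSymmetric.exists_neg_eigenvalue [FiniteDimensional ℝ E] {T : E →ₗ[ℝ] E}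
    (hT : T.IsSymmetric) {u : E} (hu : inner ℝ u (T u) < 0) :
    ∃ μ < (0 : ℝ), ∃ w ≠ 0, T w = μ • w := by
  by_contra! h
  refine hu.not_ge ?_
  set b := hT.eigenvectorBasis rfl with hb
  rw [← b.sum_inner_mul_inner u (T u)]
  refine Finset.sum_nonneg fun i _ => ?_
  have hi : T (b i) = (hT.eigenvalues rfl i) • b i := hT.apply_eigenvectorBasis rfl i
  have hnn : 0 ≤ hT.eigenvalues rfl i := by
    by_contra! hneg
    exact h _ hneg (b i) (b.orthonormal.ne_zero i) hi
  rw [← hT, hi, real_inner_smul_left, real_inner_comm, mul_left_comm]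
  exact mul_nonneg hnn (mul_self_nonneg _)

/-- If the positive operators `A`, `B` have no common kernel and `B - A` is not positive, then
`B + e^{iθ}A` has a nonzero imaginary eigenvalue `ib` for some angle `θ`: the spectrum lies in the
right half-plane at `θ = 0` and meets the left one at `θ = π`. -/
theorem exists_imaginary_eigenvalue_pencil [FiniteDimensional ℝ E] {A B : E →ₗ[ℝ] E}
    (hA : A.IsPositive) (hB : B.IsPositive) (hker : ∀ u, A u = 0 → B u = 0 → u = 0)
    {u : E} (hu : inner ℝ u ((B - A) u) < 0) :
    ∃ θ b : ℝ, 0 < θ ∧ 0 < b ∧ ∃ p q : E, (p ≠ 0 ∨ q ≠ 0) ∧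
      B p + (Real.cos θ • A p - Real.sin θ • A q) = -(b • q) ∧
      B q + (Real.cos θ • A q + Real.sin θ • A p) = b • p := by
  set β := Module.finBasis ℝ E
  set K : ℝ → Matrix _ _ ℂ := fun θ =>
    complexMatrix β (B + Real.cos θ • A) (Real.sin θ • A) with hKdef
  have hK : Continuous K := by
    refine continuous_matrix fun j k => ?_
    have : (fun θ => K θ j k) = fun θ =>
        ((LinearMap.toMatrix β β B j k + Real.cos θ * LinearMap.toMatrix β β A j k : ℝ) : ℂ) +
          ((Real.sin θ * LinearMap.toMatrix β β A j k : ℝ) : ℂ) * Complex.I := by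
      funext θ
      apply Complex.ext <;> simp [-Complex.ofReal_mul, -Complex.ofReal_add, -Complex.ofReal_cos,
        -Complex.ofReal_sin, hKdef, complexMatrix]
    rw [this]
    fun_prop
  have hnorm : ∀ {p q : E}, p ≠ 0 ∨ q ≠ 0 → 0 < ‖p‖ ^ 2 + ‖q‖ ^ 2 := by
    rintro p q (h | h) <;> positivity
  have hform : ∀ {p q : E}, inner ℝ p (A p) + inner ℝ q (A q) ≤ 0 →
      inner ℝ p (B p) + inner ℝ q (B q) ≤ 0 → p = 0 ∧ q = 0 := by
    intro p q h1 h2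
    have := hA.inner_nonneg_right p
    have := hA.inner_nonneg_right q
    have := hB.inner_nonneg_right p
    have := hB.inner_nonneg_right q
    exact ⟨hker p (hA.apply_eq_zero_of_inner_eq_zero (by linarith))
        (hB.apply_eq_zero_of_inner_eq_zero (by linarith)),
      hker q (hA.apply_eq_zero_of_inner_eq_zero (by linarith))
        (hB.apply_eq_zero_of_inner_eq_zero (by linarith))⟩
  have hzero : ∀ z ∈ spectrum ℂ (K 0), 0 < z.re := by
    intro z hz
    obtain ⟨p, q, hpq, h₁, h₂⟩ := (mem_spectrum_complexMatrix_iff _ _ _ _).1 hz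
    have h := (pencil_energy hA.isSymmetric hB.isSymmetric h₁ h₂).1
    by_contra! hre
    have := mul_nonpos_of_nonpos_of_nonneg hre (hnorm hpq).le
    have := hA.inner_nonneg_right p
    have := hA.inner_nonneg_right q
    have := hB.inner_nonneg_right p
    have := hB.inner_nonneg_right q
    rw [Real.cos_zero, one_mul] at h
    obtain ⟨hp, hq⟩ := hform (p := p) (q := q) (by linarith) (by linarith)
    exact hpq.elim (· hp) (· hq)
  have hpi : ∃ z ∈ spectrum ℂ (K Real.pi), z.re < 0 := by
    obtain ⟨μ, hμ, w, hw, hTw⟩ :=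
      (hB.isSymmetric.sub hA.isSymmetric).exists_neg_eigenvalue hu
    refine ⟨μ, (mem_spectrum_complexMatrix_iff _ _ _ _).2 ⟨w, 0, Or.inl hw, ?_, ?_⟩, by simpa⟩
    · rw [LinearMap.sub_apply] at hTw
      simp [← hTw, sub_eq_add_neg]
    · simp
  obtain ⟨θ, hθ, z, hz, hre⟩ := exists_spectrum_re_eq_zero hK Real.pi_pos.le hzero hpi
  obtain ⟨p, q, hpq, h₁, h₂⟩ := (mem_spectrum_complexMatrix_iff _ _ _ _).1 hz
  obtain ⟨hx, hy⟩ := pencil_energy hA.isSymmetric hB.isSymmetric h₁ h₂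
  have hs : 0 < Real.sin θ := Real.sin_pos_of_mem_Ioo hθ
  refine ⟨θ, z.im, hθ.1, ?_, p, q, hpq, ?_, ?_⟩
  · by_contra! him
    have h0 := mul_nonpos_of_nonpos_of_nonneg him (hnorm hpq).le
    rw [← hy] at h0
    have hAle := nonpos_of_mul_nonpos_right h0 hs
    have hA0 : inner ℝ p (A p) + inner ℝ q (A q) = 0 :=
      le_antisymm hAle (add_nonneg (hA.inner_nonneg_right p) (hA.inner_nonneg_right q))
    rw [hA0, mul_zero, hre, zero_mul, add_zero] at hx
    obtain ⟨hp, hq⟩ := hform hAle hx.le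
    exact hpq.elim (· hp) (· hq)
  · simpa [hre, add_sub_assoc] using h₁
  · simpa [hre, add_assoc] using h₂

end Pencil

/-! ### Decay of the weighted energy -/

section Decay

variable {E : Type*} [NormedAddCommGroup E] [InnerProductSpace ℝ E]

/-- Young's inequality for the semi-inner product of a positive operator: the quadratic form is
nonnegative at `u + w`. -/
theorem LinearMap.IsPositive.neg_two_mul_inner_le {A : E →ₗ[ℝ] E} (hA : A.IsPositive) (u w : E) :
    -(2 * inner ℝ u (A w)) ≤ inner ℝ u (A u) + inner ℝ w (A w) := by
  have h := hA.inner_nonneg_right (u + w)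
  have hs : inner ℝ w (A u) = inner ℝ u (A w) := by rw [← hA.isSymmetric, real_inner_comm]
  simp only [map_add, inner_add_left, inner_add_right, hs] at h
  linarith

theorem LinearMap.inner_self_apply_le [FiniteDimensional ℝ E] (A : E →ₗ[ℝ] E) (u : E) :
    inner ℝ u (A u) ≤ ‖A.toContinuousLinearMap‖ * ‖u‖ ^ 2 := by
  refine (real_inner_le_norm _ _).trans ?_
  have := A.toContinuousLinearMap.le_opNorm u
  rw [LinearMap.coe_toContinuousLinearMap'] at this
  nlinarith [mul_le_mul_of_nonneg_left this (norm_nonneg u)]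

theorem Submodule.exists_coercive [FiniteDimensional ℝ E] (S : Submodule ℝ E) (T : E →ₗ[ℝ] E)
    (hT : ∀ u ∈ S, u ≠ 0 → 0 < inner ℝ u (T u)) :
    ∃ c > 0, ∀ u ∈ S, c * ‖u‖ ^ 2 ≤ inner ℝ u (T u) := by
  have hcomp : IsCompact (Metric.sphere (0 : E) 1 ∩ S) :=
    (isCompact_sphere 0 1).inter_right S.closed_of_finiteDimensional
  have hcont : Continuous fun u => inner ℝ u (T u) :=
    continuous_id.inner T.continuous_of_finiteDimensional
  obtain ⟨c, hc, hle⟩ : ∃ c > 0, ∀ u ∈ Metric.sphere (0 : E) 1 ∩ S, c ≤ inner ℝ u (T u) := by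
    rcases (Metric.sphere (0 : E) 1 ∩ S).eq_empty_or_nonempty with h | h
    · exact ⟨1, one_pos, by simp [h]⟩
    · obtain ⟨u₀, hu₀, hmin⟩ := hcomp.exists_isMinOn h hcont.continuousOn
      exact ⟨_, hT u₀ hu₀.2 (ne_zero_of_mem_unit_sphere ⟨u₀, hu₀.1⟩), fun u hu => hmin hu⟩
  refine ⟨c, hc, fun u hu => ?_⟩
  rcases eq_or_ne u 0 with rfl | hne
  · simp
  have hn : 0 < ‖u‖ := norm_pos_iff.2 hne
  have h := hle (‖u‖⁻¹ • u) ⟨by simp [norm_smul, hn.ne'], S.smul_mem _ hu⟩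
  rw [map_smul, real_inner_smul_left, real_inner_smul_right, ← mul_assoc, ← sq, inv_pow] at h
  rwa [← le_inv_mul_iff₀' (by positivity)]

/-- The weighted energy method. The function
`e^{2γt} ‖v(t)‖² + ∑ i ∈ J, ∫ s in t - τ_i..t, e^{2γ(s + τ_i)} (v(s), A_i v(s))`
is nonincreasing along solutions of `v' = - B v - ∑ i ∈ J, A_i v(· - τ_i)`, because Young's
inequality bounds each delayed term by the two boundary values of the corresponding integral. -/
theorem norm_sq_le_of_delay_equation [FiniteDimensional ℝ E] {ι : Type*} (J : Finset ι)
    {A : ι → E →ₗ[ℝ] E} (hA : ∀ i, (A i).IsPositive) (B : E →ₗ[ℝ] E) {τ : ι → ℝ}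
    (hτ : ∀ i, 0 ≤ τ i) {v : ℝ → E} (hv : Continuous v)
    (hderiv : ∀ t > 0, HasDerivAt v (-(B (v t)) - ∑ i ∈ J, A i (v (t - τ i))) t) {γ : ℝ}
    (hγ : 0 ≤ γ)
    (hγv : ∀ t > 0, 2 * γ * ‖v t‖ ^ 2 +
      ∑ i ∈ J, (1 + Real.exp (2 * γ * τ i)) * inner ℝ (v t) (A i (v t)) ≤
        2 * inner ℝ (v t) (B (v t)))
    {ρ : ℝ} (hρ : ∀ i ∈ J, ∀ s ∈ Icc (-τ i) 0, ‖v s‖ ≤ ρ) (hρ0 : ‖v 0‖ ≤ ρ) {t : ℝ}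
    (ht : 0 ≤ t) :
    Real.exp (2 * γ * t) * ‖v t‖ ^ 2 ≤
      (1 + ∑ i ∈ J, Real.exp (2 * γ * τ i) * ‖(A i).toContinuousLinearMap‖ * τ i) * ρ ^ 2 := by
  set g : ι → ℝ → ℝ := fun i s => Real.exp (2 * γ * (s + τ i)) * inner ℝ (v s) (A i (v s)) with hg
  have hgc : ∀ i, Continuous (g i) := fun i => by
    have := hv.inner (𝕜 := ℝ) ((A i).continuous_of_finiteDimensional.comp hv)
    exact Continuous.mul (by fun_prop) this
  have hgnn : ∀ i s, 0 ≤ g i s := fun i s =>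
    mul_nonneg (Real.exp_pos _).le ((hA i).inner_nonneg_right _)
  set W : ℝ → ℝ := fun t =>
    Real.exp (2 * γ * t) * ‖v t‖ ^ 2 + ∑ i ∈ J, ∫ s in (t - τ i)..t, g i s with hW
  have hint : ∀ i t,
      HasDerivAt (fun t => ∫ s in (t - τ i)..t, g i s) (g i t - g i (t - τ i)) t := by
    intro i t
    have hprim : ∀ x, HasDerivAt (fun x => ∫ s in (0 : ℝ)..x, g i s) (g i x) x := fun x =>
      (hgc i).integral_hasStrictDerivAt 0 x |>.hasDerivAt
    have h := (hprim t).sub ((hprim (t - τ i)).comp_sub_const t (τ i))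
    refine h.congr_of_eventuallyEq (Eventually.of_forall fun x => ?_)
    exact (intervalIntegral.integral_interval_sub_left ((hgc i).intervalIntegrable _ _)
      ((hgc i).intervalIntegrable _ _)).symm
  have hWc : Continuous W := by
    have h : ∀ i, Continuous fun t => ∫ s in (t - τ i)..t, g i s := fun i =>
      continuous_iff_continuousAt.2 fun t => (hint i t).continuousAt
    exact Continuous.add (by fun_prop) (continuous_finsetSum _ fun i _ => h i)
  have hWd : ∀ t > 0, HasDerivAt W (2 * γ * Real.exp (2 * γ * t) * ‖v t‖ ^ 2 +
      Real.exp (2 * γ * t) * (2 * inner ℝ (v t) (-(B (v t)) - ∑ i ∈ J, A i (v (t - τ i)))) +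
      ∑ i ∈ J, (g i t - g i (t - τ i))) t := by
    intro t ht
    have he : HasDerivAt (fun t => Real.exp (2 * γ * t)) (2 * γ * Real.exp (2 * γ * t)) t := by
      simpa [mul_comm] using ((hasDerivAt_id t).const_mul (2 * γ)).exp
    exact (he.mul (hderiv t ht).norm_sq).add (HasDerivAt.fun_sum fun i _ => hint i t)
  have hWanti : AntitoneOn W (Ici 0) := by
    refine antitoneOn_of_deriv_nonpos (convex_Ici 0) hWc.continuousOn ?_ ?_
    · rw [interior_Ici]
      exact fun t ht => (hWd t ht).differentiableAt.differentiableWithinAt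
    · rw [interior_Ici]
      intro t ht
      rw [(hWd t ht).deriv]
      set e := Real.exp (2 * γ * t) with he
      have hterm : ∀ i ∈ J, -(e * (2 * inner ℝ (v t) (A i (v (t - τ i))))) +
          (g i t - g i (t - τ i)) ≤
            e * ((1 + Real.exp (2 * γ * τ i)) * inner ℝ (v t) (A i (v t))) := by
        intro i _
        have h1 : g i t = e * Real.exp (2 * γ * τ i) * inner ℝ (v t) (A i (v t)) := by
          rw [he, ← Real.exp_add, ← mul_add]
        have h2 : g i (t - τ i) = e * inner ℝ (v (t - τ i)) (A i (v (t - τ i))) := by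
          simp only [hg, sub_add_cancel, he]
        have h3 := mul_le_mul_of_nonneg_left
          ((hA i).neg_two_mul_inner_le (v t) (v (t - τ i))) (Real.exp_pos (2 * γ * t)).le
        rw [← he] at h3
        rw [h1, h2]
        linarith
      have hsum := Finset.sum_le_sum hterm
      rw [Finset.sum_add_distrib, Finset.sum_neg_distrib, ← Finset.mul_sum, ← Finset.mul_sum,
        ← Finset.mul_sum] at hsum
      have hmul := mul_le_mul_of_nonneg_left (hγv t ht) (Real.exp_pos (2 * γ * t)).le
      rw [← he] at hmul
      rw [inner_sub_right, inner_neg_right, inner_sum]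
      linarith
  have hW0 : W 0 ≤
      (1 + ∑ i ∈ J, Real.exp (2 * γ * τ i) * ‖(A i).toContinuousLinearMap‖ * τ i) * ρ ^ 2 := by
    rw [add_mul, one_mul, Finset.sum_mul]
    refine add_le_add ?_ (Finset.sum_le_sum fun i hi => ?_)
    · rw [mul_zero, Real.exp_zero, one_mul]
      gcongr
    · have hbound : ∀ s ∈ uIoc (0 - τ i) 0,
          ‖g i s‖ ≤ Real.exp (2 * γ * τ i) * ‖(A i).toContinuousLinearMap‖ * ρ ^ 2 := by
        intro s hs
        rw [zero_sub, uIoc_of_le (by linarith [hτ i])] at hs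
        have hle : inner ℝ (v s) (A i (v s)) ≤ ‖(A i).toContinuousLinearMap‖ * ρ ^ 2 :=
          ((A i).inner_self_apply_le _).trans (by gcongr; exact hρ i hi s ⟨hs.1.le, hs.2⟩)
        rw [Real.norm_of_nonneg (hgnn i s), mul_assoc]
        refine mul_le_mul ?_ hle ((hA i).inner_nonneg_right _) (Real.exp_pos _).le
        gcongr
        linarith [hs.2]
      refine (le_abs_self _).trans ((intervalIntegral.norm_integral_le_of_norm_le_const
        hbound).trans_eq ?_)
      rw [sub_sub_cancel, abs_of_nonneg (hτ i)]
      ring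
  refine le_trans ?_ ((hWanti self_mem_Ici ht ht).trans hW0)
  refine le_add_of_nonneg_right (Finset.sum_nonneg fun i _ => ?_)
  exact intervalIntegral.integral_nonneg (by linarith [hτ i]) fun s _ => hgnn i s

end Decay

/-! ### Laplacians with symmetric weights -/

section Laplacian

variable {N d : ℕ}

theorem mem_graphH1_iff {f : GraphL2 N d} : f ∈ graphH1 N d ↔ ∑ x, f x = 0 := by
  change (N : ℝ)⁻¹ • ∑ x, f x = 0 ↔ _
  rcases N.eq_zero_or_pos with rfl | hN
  · simp
  · simp [hN.ne']

theorem weightedLaplacian_mem_graphH1 {w : Fin N → Fin N → ℝ} (hw : ∀ x y, w x y = w y x)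
    (f : GraphL2 N d) : weightedLaplacian d w f ∈ graphH1 N d := by
  rw [mem_graphH1_iff]
  change ∑ x, ∑ y, w x y • (f y - f x) = 0
  have h : ∑ x, ∑ y, w x y • (f y - f x) = -∑ x, ∑ y, w x y • (f y - f x) := by
    conv_lhs => rw [Finset.sum_comm]
    simp only [← Finset.sum_neg_distrib, ← smul_neg, neg_sub]
    exact Finset.sum_congr rfl fun x _ => Finset.sum_congr rfl fun y _ => by rw [hw y x]
  have h2 := add_eq_zero_iff_eq_neg.2 h
  rw [← two_smul ℝ] at h2
  exact (smul_eq_zero.1 h2).resolve_left two_ne_zero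

/-- Summation by parts. -/
theorem two_mul_inner_weightedLaplacian {w : Fin N → Fin N → ℝ} (hw : ∀ x y, w x y = w y x)
    (f g : GraphL2 N d) : 2 * inner ℝ f (weightedLaplacian d w g) =
      -∑ x, ∑ y, w x y * inner ℝ (f y - f x) (g y - g x) := by
  have h1 : inner ℝ f (weightedLaplacian d w g) = ∑ x, ∑ y, w x y * inner ℝ (f x) (g y - g x) := by
    rw [GraphL2.inner_eq_sum]
    refine Finset.sum_congr rfl fun x _ => ?_
    change inner ℝ (f x) (∑ y, w x y • (g y - g x)) = _
    simp only [inner_sum, real_inner_smul_right]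
  have h2 : inner ℝ f (weightedLaplacian d w g) =
      ∑ x, ∑ y, -(w x y * inner ℝ (f y) (g y - g x)) := by
    rw [h1, Finset.sum_comm]
    refine Finset.sum_congr rfl fun x _ => Finset.sum_congr rfl fun y _ => ?_
    rw [hw y x, ← mul_neg, ← inner_neg_right, neg_sub]
  rw [two_mul]
  nth_rw 1 [h1]
  rw [h2]
  simp only [← Finset.sum_add_distrib, ← Finset.sum_neg_distrib, inner_sub_left]
  exact Finset.sum_congr rfl fun x _ => Finset.sum_congr rfl fun y _ => by ring

theorem isPositive_neg_weightedLaplacian {w : Fin N → Fin N → ℝ} (hw : ∀ x y, w x y = w y x)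
    (hnn : ∀ x y, 0 ≤ w x y) : (-weightedLaplacian d w).IsPositive := by
  constructor
  · intro f g
    have h1 := two_mul_inner_weightedLaplacian hw f g
    have h2 := two_mul_inner_weightedLaplacian hw g f
    have h3 : ∑ x, ∑ y, w x y * inner ℝ (f y - f x) (g y - g x) =
        ∑ x, ∑ y, w x y * inner ℝ (g y - g x) (f y - f x) := by
      simp only [real_inner_comm]
    rw [LinearMap.neg_apply, LinearMap.neg_apply, inner_neg_left, inner_neg_right,
      real_inner_comm]
    linarith
  · intro f
    have h1 := two_mul_inner_weightedLaplacian hw f f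
    have h2 : 0 ≤ ∑ x, ∑ y, w x y * inner ℝ (f y - f x) (f y - f x) :=
      Finset.sum_nonneg fun x _ => Finset.sum_nonneg fun y _ =>
        mul_nonneg (hnn x y) real_inner_self_nonneg
    rw [LinearMap.neg_apply, inner_neg_left, real_inner_comm, RCLike.re_to_real]
    linarith

end Laplacian

namespace DelayNetwork

variable {N r : ℕ} (G : DelayNetwork N r)

theorem subWeight_symm (i : Fin r) (x y : Fin N) : G.subWeight i x y = G.subWeight i y x := by
  have h : (∃ h : G.nbr x y, G.label x y h = i) ↔ ∃ h : G.nbr y x, G.label y x h = i :=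
    ⟨fun ⟨h, hi⟩ => ⟨G.nbr_symm x y h, (G.label_symm x y h).trans hi⟩,
      fun ⟨h, hi⟩ => ⟨G.nbr_symm y x h, (G.label_symm y x h).trans hi⟩⟩
  classical
  unfold subWeight
  rw [G.weight_symm x y]
  split_ifs <;> tauto

theorem subWeight_nonneg (i : Fin r) (x y : Fin N) : 0 ≤ G.subWeight i x y := by
  unfold subWeight
  split_ifs
  · exact G.weight_nonneg x y
  · exact le_rfl

theorem subLaplacian_mem_graphH1 {d : ℕ} (i : Fin r) (f : GraphL2 N d) :
    G.subLaplacian d i f ∈ graphH1 N d :=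
  weightedLaplacian_mem_graphH1 (G.subWeight_symm i) f

theorem isPositive_neg_subLaplacian (d : ℕ) (i : Fin r) : (-G.subLaplacian d i).IsPositive :=
  isPositive_neg_weightedLaplacian (G.subWeight_symm i) (G.subWeight_nonneg i)

/-! ### Stability for all delays -/

/-- If the undelayed Laplacian dominates the others, a small rate `γ` meets the hypothesis of
`norm_sq_le_of_delay_equation`, since at `γ = 0` it holds with a margin. -/
theorem globallyExponentiallyStable_of_ltOnH1 (d : ℕ) (i' : Fin r)
    (hlt : LtOnH1 (G.subLaplacian d i') (∑ i ∈ Finset.univ.erase i', G.subLaplacian d i))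
    (τ : Fin r → ℝ) (hτ : ∀ i, 0 ≤ τ i) (hτ' : τ i' = 0) :
    G.GloballyExponentiallyStable d τ := by
  set J := Finset.univ.erase i'
  set A : Fin r → GraphL2 N d →ₗ[ℝ] GraphL2 N d := fun i => -G.subLaplacian d i with hAdef
  have hA : ∀ i, (A i).IsPositive := fun i => G.isPositive_neg_subLaplacian d i
  obtain ⟨c, hc, hcoer⟩ := (graphH1 N d).exists_coercive _ hlt
  have hcoer' : ∀ u ∈ graphH1 N d,
      c * ‖u‖ ^ 2 + ∑ i ∈ J, inner ℝ u (A i u) ≤ inner ℝ u (A i' u) := by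
    intro u hu
    have h := hcoer u hu
    simp only [LinearMap.sub_apply, LinearMap.sum_apply, inner_sub_right, inner_sum] at h
    simp only [hAdef, LinearMap.neg_apply, inner_neg_right, Finset.sum_neg_distrib]
    linarith
  obtain ⟨γ, hγsmall, hγ⟩ : ∃ γ : ℝ, 2 * γ + ∑ i ∈ J, (Real.exp (2 * γ * τ i) - 1) *
      ‖(A i).toContinuousLinearMap‖ < 2 * c ∧ 0 < γ := by
    have hcont : Continuous fun γ : ℝ => 2 * γ + ∑ i ∈ J, (Real.exp (2 * γ * τ i) - 1) *
        ‖(A i).toContinuousLinearMap‖ := by fun_prop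
    have hev := (hcont.tendsto 0).eventually_lt_const (u := 2 * c) (by simpa using hc)
    exact ((hev.filter_mono nhdsWithin_le_nhds).and (self_mem_nhdsWithin (s := Ioi 0))).exists
  set C : ℝ := 1 + ∑ i ∈ J, Real.exp (2 * γ * τ i) * ‖(A i).toContinuousLinearMap‖ * τ i
  have hC : 0 < C := add_pos_of_pos_of_nonneg one_pos <| Finset.sum_nonneg fun i _ =>
    mul_nonneg (by positivity) (hτ i)
  refine ⟨√C, Real.sqrt_pos.2 hC, γ, hγ, fun v hv ρ hρ t ht => ?_⟩
  set T := ⨆ i, τ i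
  have hτT : ∀ i, τ i ≤ T := fun i => le_ciSup (finite_range τ).bddAbove i
  have hT : 0 ≤ T := (hτ i').trans (hτT i')
  -- The values of a solution before `-T` are arbitrary; freezing it there makes it continuous.
  set u : ℝ → GraphL2 N d := fun t => v (max t (-T)) with hu
  have huv : ∀ t, -T ≤ t → u t = v t := fun t ht => by simp only [hu, max_eq_left ht]
  have huc : Continuous u :=
    hv.continuousOn.comp_continuous (by fun_prop) fun t => le_max_right t (-T)
  have hu1 : ∀ t, 0 ≤ t → u t ∈ graphH1 N d := fun t ht => by
    rw [huv t (by linarith)]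
    exact hv.mem_H1 t (mem_Ici.2 (by linarith))
  have hud : ∀ t > 0, HasDerivAt u (-(A i' (u t)) - ∑ i ∈ J, A i (u (t - τ i))) t := by
    intro t ht
    have h := (hv.hasDeriv t ht.le).hasDerivAt (Ici_mem_nhds ht)
    have heq : ∑ i, G.subLaplacian d i (v (t - τ i)) =
        -(A i' (u t)) - ∑ i ∈ J, A i (u (t - τ i)) := by
      rw [← Finset.add_sum_erase _ _ (Finset.mem_univ i'), hτ', sub_zero, huv t (by linarith)]
      simp only [hAdef, LinearMap.neg_apply, neg_neg, Finset.sum_neg_distrib, sub_neg_eq_add]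
      congr 1
      exact Finset.sum_congr rfl fun i _ => by rw [huv _ (by linarith [hτT i])]
    rw [heq] at h
    refine h.congr_of_eventuallyEq ?_
    filter_upwards [Ioi_mem_nhds ht] with s hs
    exact huv s (by linarith [mem_Ioi.1 hs])
  have hmargin : ∀ t > 0, 2 * γ * ‖u t‖ ^ 2 +
      ∑ i ∈ J, (1 + Real.exp (2 * γ * τ i)) * inner ℝ (u t) (A i (u t)) ≤
        2 * inner ℝ (u t) (A i' (u t)) := by
    intro t ht
    have h1 := hcoer' _ (hu1 t ht.le)
    have h2 : ∀ i ∈ J, (1 + Real.exp (2 * γ * τ i)) * inner ℝ (u t) (A i (u t)) ≤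
        2 * inner ℝ (u t) (A i (u t)) +
          (Real.exp (2 * γ * τ i) - 1) * ‖(A i).toContinuousLinearMap‖ * ‖u t‖ ^ 2 := by
      intro i _
      have hexp : 0 ≤ Real.exp (2 * γ * τ i) - 1 := by
        rw [sub_nonneg, Real.one_le_exp_iff]
        have := hτ i
        positivity
      have := mul_le_mul_of_nonneg_left ((A i).inner_self_apply_le (u t)) hexp
      linarith
    have h3 := Finset.sum_le_sum h2
    rw [Finset.sum_add_distrib, ← Finset.mul_sum, ← Finset.sum_mul] at h3
    have h4 := mul_le_mul_of_nonneg_right hγsmall.le (sq_nonneg ‖u t‖)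
    linarith
  have hbound := norm_sq_le_of_delay_equation J hA (A i') hτ huc hud hγ.le hmargin (ρ := ρ)
    (fun i _ s hs => by
      have hs' : -T ≤ s := by linarith [hs.1, hτT i]
      rw [huv s hs']
      exact hρ s ⟨hs', hs.2⟩)
    (by
      rw [huv 0 (by linarith)]
      exact hρ 0 ⟨by linarith, le_rfl⟩) ht
  rw [huv t (by linarith)] at hbound
  have hρ0 : 0 ≤ ρ := (norm_nonneg _).trans (hρ 0 ⟨by linarith, le_rfl⟩)
  refine (sq_le_sq₀ (norm_nonneg _) (by positivity)).1 ?_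
  have hexp : Real.exp (-γ * t) ^ 2 * Real.exp (2 * γ * t) = 1 := by
    rw [← Real.exp_nat_mul, ← Real.exp_add, Real.exp_eq_one_iff]
    push_cast
    ring
  calc ‖v t‖ ^ 2 = Real.exp (-γ * t) ^ 2 * (Real.exp (2 * γ * t) * ‖v t‖ ^ 2) := by
        rw [← mul_assoc, hexp, one_mul]
    _ ≤ Real.exp (-γ * t) ^ 2 * (C * ρ ^ 2) := by gcongr
    _ = (√C * Real.exp (-γ * t) * ρ) ^ 2 := by
        rw [mul_pow, mul_pow, Real.sq_sqrt hC.le]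
        ring

/-! ### Periodic solutions -/

/-- If the undelayed operator does not dominate on `H¹`, equal delays of the other labels can be
chosen so that some solution is a nonzero constant or a nonzero oscillation
`cos(bt) p + sin(bt) q`, the real part of `e^{-ibt}(p + iq)`. -/
theorem leOnH1_of_tendsto_zero (d : ℕ) (i' : Fin r)
    (hconv : ∀ τ : Fin r → ℝ, (∀ i, 0 ≤ τ i) → τ i' = 0 →
      ∀ v : ℝ → GraphL2 N d, G.IsSolution τ v → Tendsto v atTop (𝓝 0)) :
    LeOnH1 (G.subLaplacian d i') (∑ i ∈ Finset.univ.erase i', G.subLaplacian d i) := by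
  set J := Finset.univ.erase i'
  intro u₀ hu₀ _
  by_contra! hneg
  have hpos : ∀ S : Finset (Fin r), (-∑ i ∈ S, G.subLaplacian d i).IsPositive := fun S => by
    rw [← Finset.sum_neg_distrib]
    exact LinearMap.isPositive_sum S fun i _ => G.isPositive_neg_subLaplacian d i
  have hmaps : ∀ S : Finset (Fin r), ∀ f ∈ graphH1 N d,
      (-∑ i ∈ S, G.subLaplacian d i) f ∈ graphH1 N d := fun S f _ => by
    rw [LinearMap.neg_apply, LinearMap.sum_apply]
    exact neg_mem (sum_mem fun i _ => G.subLaplacian_mem_graphH1 i f)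
  set A : graphH1 N d →ₗ[ℝ] graphH1 N d := (-∑ i ∈ J, G.subLaplacian d i).restrict (hmaps J)
  set B : graphH1 N d →ₗ[ℝ] graphH1 N d :=
    (-∑ i ∈ {i'}, G.subLaplacian d i).restrict (hmaps {i'})
  have hA : A.IsPositive := ⟨(hpos J).isSymmetric.restrict_invariant _, fun x => (hpos J).2 x⟩
  have hB : B.IsPositive :=
    ⟨(hpos {i'}).isSymmetric.restrict_invariant _, fun x => (hpos {i'}).2 x⟩
  have hAv : ∀ f : graphH1 N d, ((A f : graphH1 N d) : GraphL2 N d) =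
      -∑ i ∈ J, G.subLaplacian d i f := fun f => by
    simp [A]
  have hBv : ∀ f : graphH1 N d, ((B f : graphH1 N d) : GraphL2 N d) =
      -G.subLaplacian d i' f := fun f => by
    simp [B]
  have hker : ∀ f, A f = 0 → B f = 0 → f = 0 := by
    intro f hAf hBf
    have hsol : G.IsSolution (fun _ => 0) fun _ => (f : GraphL2 N d) := by
      refine ⟨continuousOn_const, fun _ _ => f.2, fun t _ => ?_⟩
      have h1 := hAv f
      have h2 := hBv f
      rw [hAf, ZeroMemClass.coe_zero, eq_comm, neg_eq_zero] at h1
      rw [hBf, ZeroMemClass.coe_zero, eq_comm, neg_eq_zero] at h2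
      rw [← Finset.add_sum_erase _ _ (Finset.mem_univ i'), h1, h2, add_zero]
      exact hasDerivWithinAt_const _ _ _
    have := hconv _ (fun _ => le_rfl) rfl _ hsol
    exact Subtype.ext (tendsto_nhds_unique tendsto_const_nhds this)
  have hneg' : inner ℝ (⟨u₀, hu₀⟩ : graphH1 N d) ((B - A) ⟨u₀, hu₀⟩) < 0 := by
    rw [Submodule.coe_inner, LinearMap.sub_apply, Submodule.coe_sub, hAv, hBv]
    refine lt_of_eq_of_lt (congrArg (inner ℝ u₀) ?_) hneg
    rw [LinearMap.sub_apply, LinearMap.sum_apply]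
    abel
  obtain ⟨θ, b, hθ, hb, p, q, hpq, h₁, h₂⟩ := exists_imaginary_eigenvalue_pencil hA hB hker hneg'
  -- The delay `θ / b` turns the shift of time into the rotation by `θ`.
  set τ : Fin r → ℝ := fun i => if i = i' then 0 else θ / b
  have hτ : ∀ i, 0 ≤ τ i := fun i => by
    simp only [τ]
    split_ifs <;> positivity
  set v : ℝ → graphH1 N d := fun t => Real.cos (b * t) • p + Real.sin (b * t) • q with hv
  have hvd : ∀ t, HasDerivAt v (b • (-Real.sin (b * t) • p + Real.cos (b * t) • q)) t := by
    intro t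
    have hlin : HasDerivAt (fun t => b * t) b t := by
      simpa using (hasDerivAt_id t).const_mul b
    refine ((hlin.cos.smul_const p).add (hlin.sin.smul_const q)).congr_deriv ?_
    module
  have hveq : ∀ t, B (v t) + A (v (t - θ / b)) =
      -(b • (-Real.sin (b * t) • p + Real.cos (b * t) • q)) := by
    intro t
    have hshift : b * (t - θ / b) = b * t - θ := by field_simp
    have e : B (v t) + A (v (t - θ / b)) =
        Real.cos (b * t) • (B p + (Real.cos θ • A p - Real.sin θ • A q)) +
        Real.sin (b * t) • (B q + (Real.cos θ • A q + Real.sin θ • A p)) := by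
      simp only [hv, hshift, Real.cos_sub, Real.sin_sub, map_add, map_smul]
      module
    rw [e, h₁, h₂]
    module
  have hsol : G.IsSolution τ fun t => (v t : GraphL2 N d) := by
    have hvd' : ∀ t, HasDerivAt (fun t => (v t : GraphL2 N d))
        ((b • (-Real.sin (b * t) • p + Real.cos (b * t) • q) : graphH1 N d) : GraphL2 N d) t :=
      fun t => (graphH1 N d).subtypeL.hasFDerivAt.comp_hasDerivAt t (hvd t)
    refine ⟨fun t _ => (hvd' t).continuousAt.continuousWithinAt, fun t _ => (v t).2,
      fun t _ => ?_⟩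
    refine ((hvd' t).congr_deriv ?_).hasDerivWithinAt
    have h := congrArg (Subtype.val) (hveq t)
    rw [Submodule.coe_add, hAv, hBv, Submodule.coe_neg, ← neg_add, neg_inj] at h
    rw [← h, ← Finset.add_sum_erase _ _ (Finset.mem_univ i')]
    congr 1
    · simp [τ]
    · rw [Finset.sum_congr rfl fun i hi => ?_]
      simp [τ, Finset.ne_of_mem_erase hi]
  have hlim := hconv τ hτ (if_pos rfl) _ hsol
  have hperiod : ∀ s w, (∀ n : ℕ, v (n * (2 * Real.pi / b) + s) = w) → w = 0 := by
    intro s w hw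
    have hseq : Tendsto (fun n : ℕ => n * (2 * Real.pi / b) + s) atTop atTop :=
      tendsto_atTop_add_const_right _ _
        (tendsto_natCast_atTop_atTop.atTop_mul_const (by positivity))
    have h := hlim.comp hseq
    simp only [Function.comp_def, hw] at h
    exact Subtype.ext (tendsto_nhds_unique tendsto_const_nhds h)
  have hp : p = 0 := hperiod 0 p fun n => by
    have : b * (n * (2 * Real.pi / b) + 0) = n * (2 * Real.pi) := by field_simp; ring
    have hsin : Real.sin (n * (2 * Real.pi)) = 0 := by
      simpa using Real.sin_add_nat_mul_two_pi 0 n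
    simp only [hv]
    rw [this, hsin, Real.cos_nat_mul_two_pi, one_smul, zero_smul, add_zero]
  have hq : q = 0 := hperiod (Real.pi / 2 / b) q fun n => by
    have : b * (n * (2 * Real.pi / b) + Real.pi / 2 / b) = Real.pi / 2 + n * (2 * Real.pi) := by
      field_simp; ring
    simp [hv, this, Real.cos_add_nat_mul_two_pi, Real.sin_add_nat_mul_two_pi]
  exact hpq.elim (· hp) (· hq)

end DelayNetwork

theorem mainTheorem5 {N r : ℕ} (d : ℕ) (G : DelayNetwork N r) (i' : Fin r) :
    (LtOnH1 (G.subLaplacian d i') (∑ i ∈ Finset.univ.erase i', G.subLaplacian d i) →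
      ∀ τ : Fin r → ℝ, (∀ i, 0 ≤ τ i) → τ i' = 0 → G.GloballyExponentiallyStable d τ) ∧
    ((∀ τ : Fin r → ℝ, (∀ i, 0 ≤ τ i) → τ i' = 0 → G.GloballyAsymptoticallyStable d τ) →
      LeOnH1 (G.subLaplacian d i') (∑ i ∈ Finset.univ.erase i', G.subLaplacian d i)) :=
  ⟨G.globallyExponentiallyStable_of_ltOnH1 d i', fun h =>
    G.leOnH1_of_tendsto_zero d i' fun τ hτ hτ' => (h τ hτ hτ').2⟩
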